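/- **Automata.** All parity conditions are min-parity on transitions: a sequence of priorities is accepting if the least priority occurring infinitely often is even. A parity automaton has transitions $(q,a,c,q')$ with letter $a$ and priority $c$; its language $L(\cdot)$ is the set of infinite words having an accepting run from an initial state. An $\varepsilon$-automaton over $\Gamma$ is a parity automaton over $\Gamma\uplus\{\varepsilon\}$; its language is the set of $w\in\Gamma^\omega$ obtained by erasing all $\varepsilon$'s from some accepted $w'\in(\Gamma\uplus\{\varepsilon\})^\omega$. Write $p\xrightarrow{\varepsilon:c}q$ if $(p,\varepsilon,c,q)$ is a transition. An $\varepsilon$-automaton is *$\varepsilon$-complete* with index $\{0,\dots,2d+1\}$ if all its priorities lie in this index and: (1) $\xrightarrow{\varepsilon:1},\xrightarrow{\varepsilon:3},\dots,\xrightarrow{\varepsilon:2d+1}$ are total preorders, each refining (contained in) the previous one; (2) for all $0\le i\le d$ and all $p,q$: $p\xrightarrow{\varepsilon:2i}q$ if and only if not $q\xrightarrow{\varepsilon:2i+1}p$. **Ordered Büchi automata.** Let $Q$ be a finite totally ordered set with $n=|Q|\ge 1$ elements. On $Q\times\{0,1\}\times Q$ let $(p,c,q)\preceq(p',c',q')$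 mean: $p\le p'$, $q'\le q$, and $c\le c'$ if $(p,q)=(p',q')$. An ordered Büchi automaton $\mathcal A=(Q,\le,I,\Gamma)$ consists of a downward closed $I\subseteq Q$ and a set $\Gamma$ of $\preceq$-upward closed subsets ("tiles") $t\subseteq Q\times\{0,1\}\times Q$. Write $p\xrightarrow{t:c}q$ for $(p,c,q)\in t$ and $p\xrightarrow{t}q$ if this holds for some $c$; $t(X)=\{q\mid\exists p\in X,\ p\xrightarrow{t}q\}$; and $\delta_t(p)=\max\{q\mid p\xrightarrow{t}q\}$, or $\bot$ if there is no such $q$. **Determinization.** A *record* is a (possibly empty) tuple $s=(s(0),\dots,s(k-1))$ of pairwise distinct states whose image is downward closed and whose first entry, if any, is its maximum. The automaton $\mathcal A_D$ has alphabet $\Gamma$, all records as states, and as only initial state the record listing $I$ in decreasing order. For a record $s$ of length $k$ and $t\in\Gamma$ it has exactly one transition $(s,t,c,s')$, defined as follows. Let $\mathrm{best}(i)=\delta_t(s(i))$ for $i<k$, let $P$ be the set of $i<k$ with $\mathrm{best}(i)\ne\bot$ and $\mathrm{best}(j)\neq\mathrm{best}(i)$ for all $j<i$, and let $R=t(\mathrm{img}\,s)\setminus\mathrm{best}(P)$.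 Then $s'$ lists first $\mathrm{best}(i)$ for $i\in P$, in increasing order of $i$, and then the elements of $R$ in decreasing order. Moreover $c=\min(2g,2r-1)$ with $g=\min\{i\mid s(i)\xrightarrow{t:0}s'(i)\}$ and $r=\min(\{0,\dots,k-1\}\setminus P)$, where the minimum of the empty set is $|t(\mathrm{img}\,s)|$. For $0\le i<n$ let $\le^i_{\mathrm{lex}}$ be the lexicographic preorder on records given by their first $i+1$ entries (missing entries being filled with $\bot$, smaller than every state), and $<^i_{\mathrm{lex}}$ its strict variant. Let $$\Delta_\varepsilon=\bigcup_{0\le i<n}\Big(\{(s,\varepsilon,2i,s')\mid s'<^i_{\mathrm{lex}}s\}\cup\{(s',\varepsilon,2i+1,s)\mid s\le^i_{\mathrm{lex}}s'\}\Big).$$ **Lemma.** For every ordered Büchi automaton $\mathcal A$ as above, adding $\Delta_\varepsilon$ to $\mathcal A_D$ makes it $\varepsilon$-complete without changing its language. Precisely, all priorities of $\mathcal A_D$ lie in $\{-1,\dots,2n-1\}$, the $\varepsilon$-automaton $\mathcal A_D\cup\Delta_\varepsilon$ satisfies (1) and (2) with $d=n-1$, and $L(\mathcal A_D\cup\Delta_\varepsilon)=L(\mathcal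 A_D)$. Moreover, if $\mathcal A_D'$ denotes $\mathcal A_D$ with priority $-1$ replaced by $1$, then $\mathcal A_D'\cup\Delta_\varepsilon$ is $\varepsilon$-complete with index $\{0,\dots,2n-1\}$, and $L(\mathcal A_D'\cup\Delta_\varepsilon)=L(\mathcal A_D)$. All of these assertions about $\mathcal A_D\cup\Delta_\varepsilon$ and $\mathcal A_D'\cup\Delta_\varepsilon$ remain true, with the same $n$ and the same language $L(\mathcal A_D)$, if these automata are restricted to any set of records that contains all the records accessible in $\mathcal A_D$ (in particular, to the accessible ones). -/

import Mathlib

namespace OrderedBuchi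

/-! ### Parity automata (min-parity condition, transition based) -/

/-- A sequence of priorities is parity accepting when its inferior limit (the least value that
occurs infinitely often) exists and is even. -/
def ParityAccepting (c : ℕ → ℤ) : Prop :=
  ∃ m : ℤ, Even m ∧ (∀ᶠ k in Filter.atTop, m ≤ c k) ∧ (∃ᶠ k in Filter.atTop, c k = m)

/-- A non-deterministic parity automaton; `(q, a, c, q') ∈ trans` is a transition from `q` to `q'`
over the letter `a` with priority `c`. -/
structure ParityAutomaton (Letter State : Type*) where
  init : Set State
  trans : Set (State × Letter × ℤ × State)

namespace ParityAutomaton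

variable {Letter State : Type*}

/-- All priorities belong to the index `[lo, hi]`. -/
def HasIndex (A : ParityAutomaton Letter State) (lo hi : ℤ) : Prop :=
  ∀ q a c q', (q, a, c, q') ∈ A.trans → c ∈ Set.Icc lo hi

/-- The language: the infinite words with an accepting run. -/
def language (A : ParityAutomaton Letter State) : Set (ℕ → Letter) :=
  {w | ∃ (q : ℕ → State) (c : ℕ → ℤ), q 0 ∈ A.init ∧
    (∀ k, (q k, w k, c k, q (k + 1)) ∈ A.trans) ∧ ParityAccepting c}

/-- The states accessible from the initial states. -/
inductive Accessible (A : ParityAutomaton Letter State) : State → Prop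
  | init (q : State) (h : q ∈ A.init) : Accessible A q
  | step (q : State) (a : Letter) (c : ℤ) (q' : State) (hq : Accessible A q)
      (h : (q, a, c, q') ∈ A.trans) : Accessible A q'

/-- The automaton restricted to a set of states. -/
def restrict (A : ParityAutomaton Letter State) (X : Set State) : ParityAutomaton Letter X where
  init := {q | (q : State) ∈ A.init}
  trans := {δ | ((δ.1 : State), δ.2.1, δ.2.2.1, (δ.2.2.2 : State)) ∈ A.trans}

/-- Replace the priority `-1` by the priority `1`. -/
def normalize (A : ParityAutomaton Letter State) : ParityAutomaton Letter State where
  init := A.init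
  trans := {δ | ∃ c : ℤ, (δ.1, δ.2.1, c, δ.2.2.2) ∈ A.trans ∧
    δ.2.2.1 = if c = -1 then 1 else c}

/-- Add a set `E` of `ε`-transitions. An `ε`-automaton over `Letter` is an automaton over
`Option Letter`, where `none` is the letter `ε`. -/
def addEps (A : ParityAutomaton Letter State) (E : Set (State × ℤ × State)) :
    ParityAutomaton (Option Letter) State where
  init := A.init
  trans := {δ | (∃ a, δ.2.1 = some a ∧ (δ.1, a, δ.2.2) ∈ A.trans) ∨ (δ.2.1 = none ∧ (δ.1, δ.2.2) ∈ E)}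

/-- `w` is obtained from `w'` by removing all the occurrences of `ε`. -/
def IsEpsErasure (w' : ℕ → Option Letter) (w : ℕ → Letter) : Prop :=
  ∃ g : ℕ → ℕ, StrictMono g ∧ (∀ j, w' (g j) = some (w j)) ∧ ∀ m, w' m ≠ none → m ∈ Set.range g

/-- The language over `Letter` of an `ε`-automaton. -/
def epsLanguage (A : ParityAutomaton (Option Letter) State) : Set (ℕ → Letter) :=
  {w | ∃ w' ∈ A.language, IsEpsErasure w' w}

/-- `q →[ε : c] q'`. -/
def EpsRel (A : ParityAutomaton (Option Letter) State) (c : ℤ) (q q' : State) : Prop :=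
  (q, none, c, q') ∈ A.trans

/-- The two conditions on `ε`-transitions in the definition of `ε`-completeness, for the priorities
`0, 1, …, 2 d + 1`. -/
structure EpsPreorders (A : ParityAutomaton (Option Letter) State) (d : ℕ) : Prop where
  trans_odd : ∀ i : ℕ, i ≤ d → ∀ p q r, A.EpsRel (2 * i + 1) p q → A.EpsRel (2 * i + 1) q r →
    A.EpsRel (2 * i + 1) p r
  total_odd : ∀ i : ℕ, i ≤ d → ∀ p q, A.EpsRel (2 * i + 1) p q ∨ A.EpsRel (2 * i + 1) q p
  refines : ∀ i : ℕ, i + 1 ≤ d → ∀ p q, A.EpsRel (2 * (i + 1) + 1) p q → A.EpsRel (2 * i + 1) p q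
  even_iff : ∀ i : ℕ, i ≤ d → ∀ p q, A.EpsRel (2 * i) p q ↔ ¬ A.EpsRel (2 * i + 1) q p

/-- `A` is `ε`-complete, with index `{0, 1, …, 2 d + 1}`. -/
def IsEpsComplete (A : ParityAutomaton (Option Letter) State) (d : ℕ) : Prop :=
  A.HasIndex 0 (2 * d + 1) ∧ A.EpsPreorders d

end ParityAutomaton

/-! ### Ordered Büchi automata -/

section

variable {Q : Type*} [LinearOrder Q]

/-- The order on Büchi transitions. -/
def TransLE (δ δ' : Q × Fin 2 × Q) : Prop :=
  δ.1 ≤ δ'.1 ∧ δ'.2.2 ≤ δ.2.2 ∧ (δ.1 = δ'.1 → δ.2.2 = δ'.2.2 → δ.2.1 ≤ δ'.2.1)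

variable (Q) in
/-- Büchi tiles that are upward closed for `TransLE`. -/
structure UpTile where
  carrier : Set (Q × Fin 2 × Q)
  up : ∀ δ δ', TransLE δ δ' → δ ∈ carrier → δ' ∈ carrier

variable (Q) in
/-- Ordered Büchi automata with the totally ordered set `Q` of states, as tile automata. -/
structure OrderedBuchiAutomaton where
  init : Set Q
  init_lower : IsLowerSet init
  tiles : Set (UpTile Q)

/-- `p →[t] q`, for some priority. -/
def UpTile.Rel (t : UpTile Q) (p q : Q) : Prop := ∃ c, (p, c, q) ∈ t.carrier

theorem rel_of_le {t : UpTile Q} {p q p' q' : Q} (h : t.Rel p q) (hp : p ≤ p') (hq : q' ≤ q) :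
    t.Rel p' q' := by
  obtain ⟨c, hc⟩ := h
  exact ⟨c, t.up (p, c, q) (p', c, q') ⟨hp, hq, fun _ _ => le_refl _⟩ hc⟩

variable (Q) in
/-- Records (the empty record included), as lists of states. -/
@[ext] structure Record where
  toList : List Q
  nodup : toList.Nodup
  lower : IsLowerSet {q | q ∈ toList}
  head_max : ∀ q ∈ toList.head?, ∀ p ∈ toList, p ≤ q

/-- The entry of index `i` of a record, or `⊥` when `i` is not in its domain. -/
def Record.entry (s : Record Q) (i : ℕ) : WithBot Q := (s.toList[i]?).elim ⊥ (fun q => (q : WithBot Q))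

/-- The entries of indices `0, …, i` of a record, in the lexicographically ordered set of tuples. -/
def Record.pre (s : Record Q) (i : ℕ) : Lex (Fin (i + 1) → WithBot Q) :=
  toLex fun j => s.entry j

/-! ### Determinization -/

variable [Fintype Q]

open Classical in
/-- The greatest `q'` with `q →[t] q'`, or `none` (that is, `⊥`) if there is none. -/
noncomputable def UpTile.ska (t : UpTile Q) (q : Q) : Option Q :=
  if h : (Finset.univ.filter fun q' => t.Rel q q').Nonempty then some (Finset.max' _ h) else none

namespace Record

/-- `best i = ska (s i)`, and `none` when `i` is not in the domain of `s`. -/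
noncomputable def best (s : Record Q) (t : UpTile Q) (i : ℕ) : Option Q := (s.toList[i]?).bind t.ska

/-- The least index with the same `best` as `i`. -/
noncomputable def leader (s : Record Q) (t : UpTile Q) (i : ℕ) : ℕ :=
  sInf {j | j < s.toList.length ∧ s.best t j = s.best t i}

open Classical in
/-- The set `P` of leaders, among the indices whose path can be extended (`best i ≠ ⊥`). -/
noncomputable def leaders (s : Record Q) (t : UpTile Q) : Finset ℕ :=
  ((Finset.range s.toList.length).filter fun i => s.best t i ≠ none).image (s.leader t)

open Classical in
/-- `t (img s)`. -/
noncomputable def succStates (s : Record Q) (t : UpTile Q) : Finset Q :=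
  Finset.univ.filter fun q' => ∃ q ∈ s.toList, t.Rel q q'

open Classical in
/-- The set `R` of reset states: `t (img s) \ best P`. -/
noncomputable def resets (s : Record Q) (t : UpTile Q) : Finset Q :=
  (s.succStates t).filter fun q' => ∀ i ∈ s.leaders t, s.best t i ≠ some q'

/-- The entries of the next record: the `best i` for `i ∈ P` in increasing order of the indices,
followed by the states of `R` in decreasing order. -/
noncomputable def nextList (s : Record Q) (t : UpTile Q) : List Q :=
  ((s.leaders t).sort (· ≤ ·)).filterMap (s.best t) ++ (s.resets t).sort (· ≥ ·)

theorem ska_eq_some {t : UpTile Q} {q r : Q} (h : t.ska q = some r) :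
    t.Rel q r ∧ ∀ r', t.Rel q r' → r' ≤ r := by
  classical
  unfold UpTile.ska at h
  split_ifs at h with hn
  have h' := Option.some.inj h
  have hm := Finset.max'_mem _ hn
  rw [h'] at hm
  refine ⟨by simpa using hm, fun r' hr' => ?_⟩
  rw [← h']
  exact Finset.le_max' _ _ (by simpa using hr')

theorem ska_exists {t : UpTile Q} {q r : Q} (h : t.Rel q r) : ∃ r', t.ska q = some r' := by
  classical
  unfold UpTile.ska
  rw [dif_pos ⟨r, by simpa using h⟩]
  exact ⟨_, rfl⟩

theorem best_eq_some {s : Record Q} {t : UpTile Q} {i : ℕ} {r : Q} (h : s.best t i = some r) :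
    ∃ q, s.toList[i]? = some q ∧ t.ska q = some r := by
  simpa [best, Option.bind_eq_some_iff] using h

theorem mem_leaders {s : Record Q} {t : UpTile Q} {i : ℕ} :
    i ∈ s.leaders t ↔ i < s.toList.length ∧ s.best t i ≠ none ∧
      ∀ j < i, s.best t j ≠ s.best t i := by
  classical
  simp only [leaders, Finset.mem_image, Finset.mem_filter, Finset.mem_range]
  constructor
  · rintro ⟨k, ⟨hk, hb⟩, rfl⟩
    have hne : {j | j < s.toList.length ∧ s.best t j = s.best t k}.Nonempty := ⟨k, hk, rfl⟩
    obtain ⟨h1, h2⟩ := Nat.sInf_mem hne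
    change s.leader t k < _ at h1
    change s.best t (s.leader t k) = _ at h2
    refine ⟨h1, by rwa [h2], fun j hj he => ?_⟩
    exact Nat.notMem_of_lt_sInf hj ⟨hj.trans h1, he.trans h2⟩
  · rintro ⟨h1, h2, h3⟩
    refine ⟨i, ⟨h1, h2⟩, ?_⟩
    have hne : {j | j < s.toList.length ∧ s.best t j = s.best t i}.Nonempty := ⟨i, h1, rfl⟩
    obtain ⟨_, h5⟩ := Nat.sInf_mem hne
    refine le_antisymm (Nat.sInf_le ⟨h1, rfl⟩) ?_
    by_contra hlt
    exact h3 _ (not_le.1 hlt) h5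

theorem mem_nextList {s : Record Q} {t : UpTile Q} {r : Q} :
    r ∈ s.nextList t ↔ ∃ q ∈ s.toList, t.Rel q r := by
  classical
  simp only [nextList, List.mem_append, List.mem_filterMap, Finset.mem_sort, resets,
    Finset.mem_filter, succStates, Finset.mem_univ, true_and]
  constructor
  · rintro (⟨i, _, hi⟩ | ⟨h, _⟩)
    · obtain ⟨q, hq, hr⟩ := best_eq_some hi
      exact ⟨q, List.mem_of_getElem? hq, (ska_eq_some hr).1⟩
    · exact h
  · intro h
    by_cases hc : ∃ i ∈ s.leaders t, s.best t i = some r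
    · exact Or.inl hc
    · push Not at hc
      exact Or.inr ⟨h, hc⟩

theorem nextList_nodup (s : Record Q) (t : UpTile Q) : (s.nextList t).Nodup := by
  classical
  refine List.Nodup.append ?_ (Finset.sort_nodup _ _) ?_
  · have hnd : ((s.leaders t).sort (· ≤ ·)).Nodup := Finset.sort_nodup _ _
    have hmem : ∀ i ∈ (s.leaders t).sort (· ≤ ·), i ∈ s.leaders t := fun i hi => by simpa using hi
    generalize (s.leaders t).sort (· ≤ ·) = l at hnd hmem
    refine List.Pairwise.filterMap _ ?_ (List.Pairwise.and_mem.1 hnd)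
    rintro i j ⟨hi, hj, hij⟩ b hb b' hb' rfl
    have h1 := mem_leaders.1 (hmem i hi)
    have h2 := mem_leaders.1 (hmem j hj)
    rcases lt_or_gt_of_ne hij with h | h
    · exact h2.2.2 i h (hb.trans hb'.symm)
    · exact h1.2.2 j h (hb'.trans hb.symm)
  · intro r h1 h2
    simp only [List.mem_filterMap, Finset.mem_sort, resets, Finset.mem_filter] at h1 h2
    obtain ⟨i, hi, hr⟩ := h1
    exact h2.2 i hi hr

theorem nextList_head (s : Record Q) (t : UpTile Q) :
    ∀ q ∈ (s.nextList t).head?, ∀ p ∈ s.nextList t, p ≤ q := by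
  classical
  intro q hq p hp
  obtain ⟨x, hx, hxp⟩ := mem_nextList.1 hp
  have hpos : 0 < s.toList.length := List.length_pos_of_mem hx
  have h0 : s.toList[0]? = some s.toList[0] := List.getElem?_eq_getElem hpos
  have hmax : ∀ y ∈ s.toList, y ≤ s.toList[0] :=
    s.head_max _ (by rw [List.head?_eq_getElem?, h0]; rfl)
  have hrel : t.Rel s.toList[0] p := rel_of_le hxp (hmax x hx) le_rfl
  obtain ⟨m, hm⟩ := ska_exists hrel
  have hb : s.best t 0 = some m := by simp [best, h0, hm]
  have hmem : 0 ∈ s.leaders t :=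
    mem_leaders.2 ⟨hpos, by simp [hb], fun j hj => absurd hj (Nat.not_lt_zero j)⟩
  have hsort : ∃ l, (s.leaders t).sort (· ≤ ·) = 0 :: l := by
    have hs : ((s.leaders t).sort (· ≤ ·)).Pairwise (· ≤ ·) := Finset.pairwise_sort _ _
    have hz : 0 ∈ (s.leaders t).sort (· ≤ ·) := by simpa using hmem
    generalize (s.leaders t).sort (· ≤ ·) = l at hs hz
    cases l with
    | nil => simp at hz
    | cons a l =>
      rcases List.mem_cons.1 hz with h | h
      · exact ⟨l, by rw [h]⟩
      · have := (List.pairwise_cons.1 hs).1 0 h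
        exact ⟨l, by rw [Nat.le_zero.1 this]⟩
  obtain ⟨l, hl⟩ := hsort
  have hhead : (s.nextList t).head? = some m := by
    simp [nextList, hl, hb]
  rw [hhead] at hq
  have : m = q := by simpa using hq
  rw [← this]
  exact (ska_eq_some hm).2 p hrel

/-- The next record. -/
noncomputable def next (s : Record Q) (t : UpTile Q) : Record Q where
  toList := s.nextList t
  nodup := nextList_nodup s t
  lower := by
    intro a b hba ha
    obtain ⟨q, hq, hr⟩ := mem_nextList.1 ha
    exact mem_nextList.2 ⟨q, hq, rel_of_le hr le_rfl hba⟩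
  head_max := nextList_head s t

/-- The minimum of a set of indices, which is `m` by convention if the set is empty. -/
def minOr (m : ℕ) (X : Finset ℕ) : ℕ := if h : X.Nonempty then X.min' h else m

open Classical in
/-- The least index that witnesses a Büchi transition. -/
noncomputable def green (s : Record Q) (t : UpTile Q) : ℕ :=
  minOr (s.succStates t).card ((Finset.range s.toList.length).filter fun i =>
    ∃ q q', s.toList[i]? = some q ∧ (s.next t).toList[i]? = some q' ∧ (q, 0, q') ∈ t.carrier)

/-- The least forgotten index. -/
noncomputable def red (s : Record Q) (t : UpTile Q) : ℕ :=
  minOr (s.succStates t).card (Finset.range s.toList.length \ s.leaders t)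

/-- The priority of the transition from `s` over `t`. -/
noncomputable def prio (s : Record Q) (t : UpTile Q) : ℤ :=
  min (2 * (s.green t : ℤ)) (2 * (s.red t : ℤ) - 1)

end Record

namespace OrderedBuchiAutomaton

open Classical in
/-- The initial record: the initial states in decreasing order. -/
noncomputable def initRecord (B : OrderedBuchiAutomaton Q) : Record Q where
  toList := (Finset.univ.filter fun q => q ∈ B.init).sort (· ≥ ·)
  nodup := Finset.sort_nodup _ _
  lower := by
    intro a b hba ha
    have ha' : a ∈ B.init := by simpa using ha
    simpa using B.init_lower hba ha'
  head_max := by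
    have hs : ((Finset.univ.filter fun q => q ∈ B.init).sort (· ≥ ·)).Pairwise (· ≥ ·) :=
      Finset.pairwise_sort _ _
    generalize (Finset.univ.filter fun q => q ∈ B.init).sort (· ≥ ·) = l at hs
    intro q hq p hp
    cases l with
    | nil => simp at hp
    | cons a l =>
      have hqa : a = q := by simpa using hq
      subst hqa
      rcases List.mem_cons.1 hp with h | h
      · exact h.le
      · exact (List.pairwise_cons.1 hs).1 p h

/-- The deterministic parity automaton obtained by determinization; its letters are the tiles of
`B`, and its transitions form the graph of the function `(s, t) ↦ (s.prio t, s.next t)`. -/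
noncomputable def det (B : OrderedBuchiAutomaton Q) : ParityAutomaton B.tiles (Record Q) where
  init := {B.initRecord}
  trans := {δ | δ.2.2 = (δ.1.prio δ.2.1.1, δ.1.next δ.2.1.1)}

end OrderedBuchiAutomaton

variable (Q) in
/-- The set of `ε`-transitions to be added. -/
def epsTransitions : Set (Record Q × ℤ × Record Q) :=
  {δ | ∃ (i : ℕ) (s s' : Record Q), i < Fintype.card Q ∧
    ((s'.pre i < s.pre i ∧ δ = (s, 2 * (i : ℤ), s')) ∨
      (s.pre i ≤ s'.pre i ∧ δ = (s', 2 * (i : ℤ) + 1, s)))}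

end

end OrderedBuchi

namespace OrderedBuchi

open Filter

/-! Conditions (1) and (2) hold because the prefix orders on records are total preorders, refined as
the prefix grows, and the even relations are their strict variants. The substance is that the
`ε`-transitions add no word, which is shown by passing through paths of the Büchi automaton.

Soundness (`exists_path_of_parityAccepting`): let `2 * e` be the least priority seen infinitely
often in an accepting run with `ε`-moves. Eventually no index `≤ e` is forgotten and no `ε`-move
increases the prefix of index `e`. Take the least `j ≤ e` whose entry is changed infinitely often by
`ε`-moves; these changes are eventually decreases. Following entry `j` gives a path with jumps
downwards, and since tiles are upward closed, a strict jump turns the preceding transition into a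
Büchi transition. If there is no such `j`, then priority `2 * e` comes infinitely often from
letters, and entry `e` itself makes Büchi transitions.

Completeness (`not_odd_liminf`, `parityAccepting_of_path`): `ε`-moves only shrink the image of a
record, so this path also lies in the records of the run of the deterministic automaton on the same
word (`mem_of_mem_run`). A path with infinitely many Büchi transitions inside the records excludes
an odd least recurrent priority.

Replacing `-1` by `1` is harmless because an accepting run never meets the empty record. Restriction
is harmless because `ε`-free runs visit only accessible records. -/

theorem length_filter_lt_of_getElem? {l : List ℕ} (h : l.Pairwise (· < ·)) {i a : ℕ}
    (hi : l[i]? = some a) : (l.filter (· < a)).length = i := by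
  induction l generalizing i with
  | nil => simp at hi
  | cons b l ih =>
    obtain ⟨hb, hl⟩ := List.pairwise_cons.1 h
    cases i with
    | zero =>
      have : b = a := by simpa using hi
      subst this
      have : l.filter (· < b) = [] := by
        rw [List.filter_eq_nil_iff]
        intro x hx
        simpa using (hb x hx).le
      simp [this]
    | succ i =>
      have hi' : l[i]? = some a := by simpa using hi
      have := hb a (List.mem_of_getElem? hi')
      simp [this, ih hl hi']

theorem getElem?_filterMap_of_forall {α β : Type*} {f : α → Option β} {l : List α}
    (h : ∀ x ∈ l, f x ≠ none) (i : ℕ) : (l.filterMap f)[i]? = l[i]?.bind f := by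
  induction l generalizing i with
  | nil => simp
  | cons a l ih =>
    obtain ⟨b, hb⟩ := Option.ne_none_iff_exists'.1 (h a (by simp))
    rw [List.filterMap_cons_some hb]
    cases i with
    | zero => simp [hb]
    | succ i => simpa using ih (fun x hx => h x (by simp [hx])) i

/-! ### Tiles, records and one step of the determinization -/

section

variable {Q : Type*} [LinearOrder Q]

/-- `TransLE` compares priorities only when both endpoints agree, so a strict change of an endpoint
allows any priority, in particular the Büchi priority `0`. All Büchi transitions that are not read
off directly come from this lemma and the next one. -/
theorem UpTile.mem_of_lt_left {t : UpTile Q} {p p' q : Q} {c c' : Fin 2}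
    (h : (p, c, q) ∈ t.carrier) (hp : p < p') : (p', c', q) ∈ t.carrier :=
  t.up (p, c, q) (p', c', q) ⟨hp.le, le_rfl, fun e => absurd e hp.ne⟩ h

theorem UpTile.mem_of_lt_right {t : UpTile Q} {p q q' : Q} {c c' : Fin 2}
    (h : (p, c, q) ∈ t.carrier) (hq : q' < q) : (p, c', q') ∈ t.carrier :=
  t.up (p, c, q) (p, c', q') ⟨le_rfl, hq.le, fun _ e => absurd e hq.ne'⟩ h

namespace Record

theorem entry_eq_coe {s : Record Q} {i : ℕ} {q : Q} :
    s.entry i = (q : WithBot Q) ↔ s.toList[i]? = some q := by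
  unfold entry
  cases s.toList[i]? <;> simp

theorem entry_eq_bot {s : Record Q} {i : ℕ} : s.entry i = ⊥ ↔ s.toList.length ≤ i := by
  unfold entry
  rw [← List.getElem?_eq_none_iff]
  cases s.toList[i]? <;> simp

theorem le_entry_zero {s : Record Q} {q : Q} (h : q ∈ s.toList) : (q : WithBot Q) ≤ s.entry 0 := by
  have hpos : 0 < s.toList.length := List.length_pos_of_mem h
  have h0 : s.toList[0]? = some s.toList[0] := List.getElem?_eq_getElem hpos
  rw [entry_eq_coe.2 h0, WithBot.coe_le_coe]
  exact s.head_max _ (by rw [List.head?_eq_getElem?, h0]; rfl) q h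

/-- The image is downward closed and its maximum comes first, so entry `0` alone determines it, and
hence also the length. -/
theorem mem_iff_le_entry_zero {s : Record Q} {q : Q} :
    q ∈ s.toList ↔ (q : WithBot Q) ≤ s.entry 0 := by
  refine ⟨le_entry_zero, fun h => ?_⟩
  cases h0 : s.toList[0]? with
  | none =>
    rw [List.getElem?_eq_none_iff] at h0
    rw [entry_eq_bot.2 h0] at h
    simp at h
  | some a =>
    rw [entry_eq_coe.2 h0, WithBot.coe_le_coe] at h
    exact s.lower h (List.mem_of_getElem? h0)

theorem length_eq_of_entry_zero_eq {s s' : Record Q} (h : s.entry 0 = s'.entry 0) :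
    s.toList.length = s'.toList.length := by
  refine ((List.perm_ext_iff_of_nodup s.nodup s'.nodup).2 fun q => ?_).length_eq
  rw [mem_iff_le_entry_zero, h, mem_iff_le_entry_zero]

/-- A lexicographic inequality gives an inequality at the first entry at which the prefixes may
differ. -/
theorem entry_le_of_pre_le {s s' : Record Q} {i j : ℕ} (hj : j ≤ i) (h : s'.pre i ≤ s.pre i)
    (he : ∀ j' < j, s'.entry j' = s.entry j') : s'.entry j ≤ s.entry j := by
  rcases h.eq_or_lt with h | h
  · have := congrFun (toLex.injective h) ⟨j, by omega⟩
    exact this.le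
  · obtain ⟨a, ha, hlt⟩ := h
    rcases lt_trichotomy j a.1 with h | h | h
    · exact (ha ⟨j, by omega⟩ h).le
    · have : s'.entry a < s.entry a := hlt
      rw [h]
      exact this.le
    · exact absurd (he a h) (ne_of_lt hlt)

theorem pre_mono {s s' : Record Q} {i j : ℕ} (hj : j ≤ i) (h : s'.pre i ≤ s.pre i) :
    s'.pre j ≤ s.pre j := by
  by_contra hc
  rw [not_le] at hc
  obtain ⟨a, ha, hlt⟩ := hc
  have := entry_le_of_pre_le (i := i) (j := a) (by omega) h
    fun j' hj' => (ha ⟨j', by omega⟩ hj').symm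
  exact absurd this (not_le.2 hlt)

theorem exists_entry_ne_of_pre_lt {s s' : Record Q} {i : ℕ} (h : s'.pre i < s.pre i) :
    ∃ j ≤ i, s'.entry j ≠ s.entry j := by
  obtain ⟨a, -, hlt⟩ := h
  exact ⟨a, by omega, ne_of_lt hlt⟩

theorem mem_of_pre_le {s s' : Record Q} {i : ℕ} (h : s'.pre i ≤ s.pre i) {q : Q}
    (hq : q ∈ s'.toList) : q ∈ s.toList := by
  rw [mem_iff_le_entry_zero] at *
  exact hq.trans (entry_le_of_pre_le (Nat.zero_le i) h (by simp))

theorem minOr_le {m : ℕ} {X : Finset ℕ} {x : ℕ} (h : x ∈ X) : minOr m X ≤ x := by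
  rw [minOr, dif_pos ⟨x, h⟩]
  exact Finset.min'_le _ _ h

theorem minOr_eq {m n : ℕ} {X : Finset ℕ} (h : minOr m X = n) : n ∈ X ∨ n = m := by
  subst h
  unfold minOr
  split_ifs with h
  · exact Or.inl (Finset.min'_mem _ h)
  · exact Or.inr rfl

variable [Fintype Q]

/-- The index in the next record of the path of a leader. -/
theorem next_getElem?_leader {s : Record Q} {t : UpTile Q} {l : ℕ} (hl : l ∈ s.leaders t) :
    (s.next t).toList[((s.leaders t).filter (· < l)).card]? = s.best t l := by
  have hsort : ((s.leaders t).sort (· ≤ ·)).Pairwise (· < ·) :=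
    (Finset.sortedLT_sort _).pairwise
  have hb : ∀ x ∈ (s.leaders t).sort (· ≤ ·), s.best t x ≠ none := fun x hx =>
    (mem_leaders.1 ((Finset.mem_sort _).1 hx)).2.1
  obtain ⟨i, hi⟩ := List.getElem?_of_mem ((Finset.mem_sort (· ≤ ·)).2 hl)
  have hlen := length_filter_lt_of_getElem? hsort hi
  have hcard : ((s.leaders t).filter (· < l)).card = i := by
    rw [← hlen, ← List.toFinset_card_of_nodup (hsort.nodup.filter _)]
    congr 1
    ext x
    simp
  have h1 : (((s.leaders t).sort (· ≤ ·)).filterMap (s.best t))[i]? = s.best t l := by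
    rw [getElem?_filterMap_of_forall hb, hi, Option.bind_some]
  obtain ⟨b, hb'⟩ := Option.ne_none_iff_exists'.1 (mem_leaders.1 hl).2.1
  rw [hb'] at h1 ⊢
  change (_ ++ _)[_]? = _
  rw [hcard, List.getElem?_append_left (List.getElem?_eq_some_iff.1 h1).1, h1]

theorem next_getElem?_of_forall_lt {s : Record Q} {t : UpTile Q} {l : ℕ}
    (hl : ∀ j ≤ l, j ∈ s.leaders t) : (s.next t).toList[l]? = s.best t l := by
  rw [← next_getElem?_leader (hl l le_rfl)]
  congr 1
  have : (s.leaders t).filter (· < l) = Finset.range l := by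
    ext x
    simp only [Finset.mem_filter, Finset.mem_range, and_iff_right_iff_imp]
    exact fun h => hl x h.le
  rw [this, Finset.card_range]

theorem card_filter_leaders_lt_le (s : Record Q) (t : UpTile Q) (l : ℕ) :
    ((s.leaders t).filter (· < l)).card ≤ l := by
  calc _ ≤ (Finset.range l).card := Finset.card_le_card fun x => by simp
    _ = l := Finset.card_range l

theorem card_filter_leaders_lt_lt {s : Record Q} {t : UpTile Q} {l r : ℕ} (hr : r < l)
    (h : r ∉ s.leaders t) : ((s.leaders t).filter (· < l)).card < l := by
  calc _ < (Finset.range l).card := Finset.card_lt_card ⟨fun x => by simp, fun hs => h ?_⟩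
    _ = l := Finset.card_range l
  exact (Finset.mem_filter.1 (hs (Finset.mem_range.2 hr))).1

theorem length_next (s : Record Q) (t : UpTile Q) :
    (s.next t).toList.length = (s.succStates t).card := by
  rw [← List.toFinset_card_of_nodup (s.next t).nodup]
  congr 1
  ext x
  rw [List.mem_toFinset]
  change x ∈ s.nextList t ↔ _
  rw [mem_nextList]
  simp [succStates]

theorem length_le_card (s : Record Q) : s.toList.length ≤ Fintype.card Q := by
  rw [← List.toFinset_card_of_nodup s.nodup]
  exact Finset.card_le_univ _

theorem mem_leaders_of_lt_red {s : Record Q} {t : UpTile Q} {j : ℕ} (hj : j < s.toList.length)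
    (h : j < s.red t) : j ∈ s.leaders t := by
  by_contra hc
  have : s.red t ≤ j := minOr_le (by simpa using ⟨hj, hc⟩)
  omega

theorem red_spec (s : Record Q) (t : UpTile Q) :
    (s.red t < s.toList.length ∧ s.red t ∉ s.leaders t) ∨
      s.red t = (s.next t).toList.length := by
  rcases minOr_eq (n := s.red t) rfl with h | h
  · left
    simpa using h
  · right
    rw [length_next, h]

theorem next_getElem?_of_lt_red {s : Record Q} {t : UpTile Q} {j : ℕ} (hj : j < s.toList.length)
    (h : j < s.red t) : (s.next t).toList[j]? = s.best t j :=
  next_getElem?_of_forall_lt fun i hi => mem_leaders_of_lt_red (by omega) (by omega)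

theorem best_ne_none_of_lt_red {s : Record Q} {t : UpTile Q} {j : ℕ} (hj : j < s.toList.length)
    (h : j < s.red t) : s.best t j ≠ none :=
  (mem_leaders.1 (mem_leaders_of_lt_red hj h)).2.1

/-- Every index below `red` is a leader and keeps its place, so it occurs in the next record; the
default value of `red` is exactly the length of that record. -/
theorem red_le_length_next (s : Record Q) (t : UpTile Q) :
    s.red t ≤ (s.next t).toList.length := by
  rcases red_spec s t with ⟨h, -⟩ | h
  · by_contra hc
    push Not at hc
    refine best_ne_none_of_lt_red (t := t) (hc.trans h) hc ?_
    rw [← next_getElem?_of_lt_red (hc.trans h) hc, List.getElem?_eq_none_iff]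
  · exact h.le

/-- Below the least forgotten index, the paths are extended by their greatest successors. -/
theorem exists_step_of_lt_red {s : Record Q} {t : UpTile Q} {j : ℕ} (hj : j < s.toList.length)
    (h : j < s.red t) : ∃ a b, s.toList[j]? = some a ∧ (s.next t).toList[j]? = some b ∧
      t.Rel a b ∧ ∀ b', t.Rel a b' → b' ≤ b := by
  obtain ⟨b, hb⟩ := Option.ne_none_iff_exists'.1 (best_ne_none_of_lt_red hj h)
  obtain ⟨a, ha, hab⟩ := best_eq_some hb
  exact ⟨a, b, ha, by rw [next_getElem?_of_lt_red hj h, hb], (ska_eq_some hab).1,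
    (ska_eq_some hab).2⟩

theorem mem_next {s : Record Q} {t : UpTile Q} {r : Q} :
    r ∈ (s.next t).toList ↔ ∃ q ∈ s.toList, t.Rel q r := mem_nextList

/-- Entry `0` is the maximum, so it has a successor as soon as some entry has one, and nothing
precedes it: index `0` is not forgotten. -/
theorem red_pos {s : Record Q} {t : UpTile Q} {q : Q} (hq : q ∈ (s.next t).toList) :
    0 < s.red t := by
  rcases red_spec s t with ⟨h, h'⟩ | h
  · by_contra hc
    have h0 : s.red t = 0 := by omega
    rw [h0] at h h'
    refine h' (mem_leaders.2 ⟨h, ?_, by simp⟩)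
    obtain ⟨p, hp, hr⟩ := mem_next.1 hq
    have ha : s.toList[0]? = some s.toList[0] := List.getElem?_eq_getElem h
    have hle := le_entry_zero hp
    rw [entry_eq_coe.2 ha, WithBot.coe_le_coe] at hle
    obtain ⟨m, hm⟩ := ska_exists (rel_of_le hr hle le_rfl)
    simp [best, ha, hm]
  · rw [h]
    exact List.length_pos_of_mem hq

theorem green_le {s : Record Q} {t : UpTile Q} {j : ℕ} {a b : Q} (ha : s.toList[j]? = some a)
    (hb : (s.next t).toList[j]? = some b) (h : (a, 0, b) ∈ t.carrier) : s.green t ≤ j := by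
  classical
  refine minOr_le ?_
  rw [Finset.mem_filter, Finset.mem_range]
  exact ⟨(List.getElem?_eq_some_iff.1 ha).1, a, b, ha, hb, h⟩

/-- The default value of `green` is the length of the next record, which is at least `red`; below
`red`, the value of `green` has a genuine witness. -/
theorem exists_of_green_lt_red {s : Record Q} {t : UpTile Q} (h : s.green t < s.red t) :
    ∃ a b, s.toList[s.green t]? = some a ∧ (s.next t).toList[s.green t]? = some b ∧
      (a, 0, b) ∈ t.carrier := by
  classical
  rcases minOr_eq (n := s.green t) rfl with h' | h'
  · exact (Finset.mem_filter.1 h').2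
  · have := red_le_length_next s t
    rw [length_next] at this
    omega

theorem prio_mem (s : Record Q) (t : UpTile Q) :
    s.prio t ∈ Set.Icc (-1 : ℤ) (2 * (Fintype.card Q : ℤ) - 1) := by
  have := red_le_length_next s t
  have := length_le_card (s.next t)
  unfold prio
  constructor <;> omega

end Record

end

/-! ### Inferior limits and eventual behaviour of sequences -/

/-- A bounded sequence of priorities has an inferior limit, which is attained infinitely often. -/
theorem exists_liminf_of_mem_Icc {c : ℕ → ℤ} {lo hi : ℤ} (h : ∀ k, c k ∈ Set.Icc lo hi) :
    ∃ m, (∀ᶠ k in atTop, m ≤ c k) ∧ ∃ᶠ k in atTop, c k = m := by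
  obtain ⟨m, hm, hmax⟩ := Int.exists_greatest_of_bdd (P := fun m => ∀ᶠ k in atTop, m ≤ c k)
    ⟨hi, fun z hz => by
      obtain ⟨k, hk⟩ := hz.exists
      exact hk.trans (h k).2⟩ ⟨lo, Eventually.of_forall fun k => (h k).1⟩
  refine ⟨m, hm, fun hne => ?_⟩
  have : m + 1 ≤ m := hmax _ (by
    filter_upwards [hm, hne] with k h1 h2
    have : c k ≠ m := h2
    omega)
  omega

theorem eventually_of_frequently_of_step {P : ℕ → Prop} (hf : ∃ᶠ k in atTop, P k)
    (hs : ∀ᶠ k in atTop, P k → P (k + 1)) : ∀ᶠ k in atTop, P k := by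
  obtain ⟨K, hK⟩ := eventually_atTop.1 hs
  obtain ⟨k, hk, hP⟩ := frequently_atTop.1 hf K
  refine eventually_atTop.2 ⟨k, fun b hb => ?_⟩
  induction b, hb using Nat.le_induction with
  | base => exact hP
  | succ b hb ih => exact hK b (hk.trans hb) ih

theorem eventually_iff_succ_of_step {P : ℕ → Prop}
    (hs : ∀ᶠ k in atTop, P k → P (k + 1)) : ∀ᶠ k in atTop, (P k ↔ P (k + 1)) := by
  by_cases hf : ∃ᶠ k in atTop, P k
  · have h := eventually_of_frequently_of_step hf hs
    filter_upwards [h, (tendsto_add_atTop_nat 1).eventually h] with k h1 h2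
    exact ⟨fun _ => h2, fun _ => h1⟩
  · rw [not_frequently] at hf
    filter_upwards [hf, (tendsto_add_atTop_nat 1).eventually hf] with k h1 h2
    exact ⟨fun h => absurd h h1, fun h => absurd h h2⟩

theorem not_frequently_lt_of_eventually_le {M : ℕ → ℕ} (h : ∀ᶠ k in atTop, M (k + 1) ≤ M k) :
    ¬ ∃ᶠ k in atTop, M (k + 1) < M k := by
  intro hf
  have key : ∀ v, ∀ᶠ k in atTop, v ≤ M k := by
    intro v
    obtain ⟨K, hK⟩ := eventually_atTop.1 h
    have hanti : ∀ a, K ≤ a → ∀ b, a ≤ b → M b ≤ M a := by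
      intro a ha b hab
      induction b, hab using Nat.le_induction with
      | base => exact le_rfl
      | succ b hb ih => exact (hK b (ha.trans hb)).trans ih
    induction v with
    | zero => simp
    | succ v ih =>
      obtain ⟨K', hK'⟩ := eventually_atTop.1 ih
      refine eventually_atTop.2 ⟨max K K', fun b hb => ?_⟩
      obtain ⟨a, ha, hlt⟩ := frequently_atTop.1 hf b
      have h1 := hK' (a + 1) (by omega)
      have h2 := hanti b (by omega) a ha
      omega
  obtain ⟨K, hK⟩ := eventually_atTop.1 h
  obtain ⟨K', hK'⟩ := eventually_atTop.1 (key (M K + 1))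
  have hanti : ∀ b, K ≤ b → M b ≤ M K := by
    intro b hab
    induction b, hab using Nat.le_induction with
    | base => exact le_rfl
    | succ b hb ih => exact (hK b hb).trans ih
  have h1 := hK' (max K K') (by omega)
  have h2 := hanti (max K K') (by omega)
  omega

/-! ### Completeness: Büchi paths make the deterministic run accepting -/

section

variable {Q : Type*} [LinearOrder Q] [Fintype Q]

open Record

/-- The first `r` entries are eventually never forgotten and make no Büchi transition, so they
separate themselves from the path. Consider the least index of a state that is above or equal to the
path but strictly below every one of the first `r` entries that is above the path. This index is at
least `r`, eventually never increases, and drops each time `red` equals `r`, which can therefore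
happen only finitely often. -/
theorem not_odd_liminf {w : ℕ → UpTile Q} {s : ℕ → Record Q}
    (hs : ∀ k, s (k + 1) = (s k).next (w k)) {p : ℕ → Q}
    (hp : ∀ᶠ k in atTop, p k ∈ (s k).toList ∧ (w k).Rel (p k) (p (k + 1)))
    (hb : ∃ᶠ k in atTop, (p k, 0, p (k + 1)) ∈ (w k).carrier) {r : ℕ}
    (hg : ∀ᶠ k in atTop, r ≤ (s k).green (w k)) (hr : ∀ᶠ k in atTop, r ≤ (s k).red (w k)) :
    ¬ ∃ᶠ k in atTop, (s k).red (w k) = r := by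
  have hlen : ∀ᶠ k in atTop, r ≤ (s k).toList.length := by
    obtain ⟨K, hK⟩ := eventually_atTop.1 hr
    refine eventually_atTop.2 ⟨K + 1, fun k hk => ?_⟩
    obtain ⟨k, rfl⟩ : ∃ k', k = k' + 1 := ⟨k - 1, by omega⟩
    rw [hs]
    exact (hK k (by omega)).trans (red_le_length_next _ _)
  -- the first `r` entries evolve by their greatest successors, without Büchi transitions
  have hstep : ∀ᶠ k in atTop, ∀ j < r, ∃ a b, (s k).toList[j]? = some a ∧
      (s (k + 1)).toList[j]? = some b ∧ ((a, 0, b) ∉ (w k).carrier) ∧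
      ∀ a' ≤ a, ∀ b', (w k).Rel a' b' → b' ≤ b := by
    filter_upwards [hlen, hg, hr] with k h1 h2 h3 j hj
    obtain ⟨a, b, ha, hb, -, hmax⟩ :=
      exists_step_of_lt_red (s := s k) (t := w k) (j := j) (by omega) (by omega)
    refine ⟨a, b, ha, by rw [hs, hb], fun hc => ?_, fun a' ha' b' hb' =>
      hmax b' (rel_of_le hb' ha' le_rfl)⟩
    have := green_le ha hb hc
    omega
  -- being at most the entry of index `j` is preserved
  have hle : ∀ j < r, ∀ᶠ k in atTop, (p k : WithBot Q) ≤ (s k).entry j →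
      (p (k + 1) : WithBot Q) ≤ (s (k + 1)).entry j := by
    intro j hj
    filter_upwards [hstep, hp] with k h1 h2 h
    obtain ⟨a, b, ha, hb, -, hmax⟩ := h1 j hj
    rw [entry_eq_coe.2 ha, WithBot.coe_le_coe] at h
    rw [entry_eq_coe.2 hb, WithBot.coe_le_coe]
    exact hmax _ h _ h2.2
  have hlt : ∀ j < r, ∀ᶠ k in atTop, (p k : WithBot Q) < (s k).entry j →
      (p (k + 1) : WithBot Q) < (s (k + 1)).entry j := by
    intro j hj
    filter_upwards [hstep, hp] with k h1 h2 h
    obtain ⟨a, b, ha, hb, hn, hmax⟩ := h1 j hj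
    rw [entry_eq_coe.2 ha, WithBot.coe_lt_coe] at h
    rw [entry_eq_coe.2 hb, WithBot.coe_lt_coe]
    refine lt_of_le_of_ne (hmax _ h.le _ h2.2) fun he => hn ?_
    obtain ⟨c, hc⟩ := h2.2
    rw [he] at hc
    exact UpTile.mem_of_lt_left hc h
  -- If the path stays below entry `j`, its next Büchi transition lands strictly below: landing on
  -- the entry would give the entry a Büchi transition by upward closure. Strictness then persists
  -- by `hlt`.
  have hne : ∀ j < r, ∀ᶠ k in atTop, (p k : WithBot Q) ≠ (s k).entry j := by
    intro j hj
    by_cases hf : ∃ᶠ k in atTop, (p k : WithBot Q) ≤ (s k).entry j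
    · have hev := eventually_of_frequently_of_step hf (hle j hj)
      have hf' : ∃ᶠ k in atTop, (p k : WithBot Q) < (s k).entry j := by
        refine (tendsto_add_atTop_nat 1).frequently ((hb.and_eventually
          (hev.and (hstep.and hp))).mono ?_)
        rintro k ⟨hk, h1, h2, h3⟩
        obtain ⟨a, b, ha, hb, hn, hmax⟩ := h2 j hj
        rw [entry_eq_coe.2 ha, WithBot.coe_le_coe] at h1
        rw [entry_eq_coe.2 hb, WithBot.coe_lt_coe]
        refine lt_of_le_of_ne (hmax _ h1 _ h3.2) fun he => hn ?_
        rw [he] at hk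
        rcases h1.eq_or_lt with h1 | h1
        · rwa [h1] at hk
        · exact UpTile.mem_of_lt_left hk h1
      exact (eventually_of_frequently_of_step hf' (hlt j hj)).mono fun k h => h.ne
    · exact (not_frequently.1 hf).mono fun k h he => h he.le
  have hiff : ∀ᶠ k in atTop, ∀ j < r, ((p k : WithBot Q) ≤ (s k).entry j ↔
      (p (k + 1) : WithBot Q) ≤ (s (k + 1)).entry j) :=
    (eventually_all_finite (Set.finite_Iio r)).2
      fun j hj => eventually_iff_succ_of_step (hle j hj)
  have hne' : ∀ᶠ k in atTop, ∀ j < r, (p k : WithBot Q) ≠ (s k).entry j :=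
    (eventually_all_finite (Set.finite_Iio r)).2 hne
  -- the indices of the states between `p k` and the first `r` entries above it
  let Good : ℕ → ℕ → Prop := fun k i => ∃ y : Q, (s k).toList[i]? = some y ∧ p k ≤ y ∧
    ∀ j < r, (p k : WithBot Q) ≤ (s k).entry j → (y : WithBot Q) < (s k).entry j
  have hgood : ∀ᶠ k in atTop, ∃ i, Good k i := by
    filter_upwards [hp, hne'] with k h1 h2
    obtain ⟨i, hi⟩ := List.getElem?_of_mem h1.1
    exact ⟨i, p k, hi, le_rfl, fun j hj hle => lt_of_le_of_ne hle (h2 j hj)⟩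
  have hge : ∀ k i, Good k i → r ≤ i := by
    rintro k i ⟨y, hy, hpy, h⟩
    by_contra hc
    have := h i (by omega) (by rwa [entry_eq_coe.2 hy, WithBot.coe_le_coe])
    rw [entry_eq_coe.2 hy] at this
    exact lt_irrefl _ this
  have hnext : ∀ᶠ k in atTop, ∀ i, Good k i →
      ∃ i' ≤ i, Good (k + 1) i' ∧ ((s k).red (w k) = r → i' < i) := by
    filter_upwards [hp, hiff, hstep] with k h1 h2 h3 i hi
    have hri := hge k i hi
    obtain ⟨y, hy, hpy, hlt⟩ := hi
    have hrel : (w k).Rel y (p (k + 1)) := rel_of_le h1.2 hpy le_rfl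
    obtain ⟨b, hb⟩ := ska_exists hrel
    obtain ⟨hyb, hmax⟩ := ska_eq_some hb
    have hbest : (s k).best (w k) i = some b := by simp [best, hy, hb]
    have hil : i < (s k).toList.length := (List.getElem?_eq_some_iff.1 hy).1
    -- The leader `l` carries the path of `y` on; its new index is the number of leaders below `l`.
    obtain ⟨l, hli, hl, hlb⟩ : ∃ l ≤ i, l ∈ (s k).leaders (w k) ∧
        (s k).best (w k) l = some b := by
      have hex : ∃ l, (s k).best (w k) l = some b := ⟨i, hbest⟩
      classical
      refine ⟨Nat.find hex, Nat.find_min' hex hbest, mem_leaders.2 ⟨?_, ?_, ?_⟩, Nat.find_spec hex⟩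
      · exact (Nat.find_min' hex hbest).trans_lt hil
      · simp [Nat.find_spec hex]
      · intro j hj he
        exact Nat.find_min hex hj (he.trans (Nat.find_spec hex))
    have hidx := next_getElem?_leader hl
    rw [← hs, hlb] at hidx
    have hgood' : Good (k + 1) (((s k).leaders (w k)).filter (· < l)).card := by
      refine ⟨b, hidx, hmax _ hrel, fun j hj hle => ?_⟩
      have hyj := hlt j hj ((h2 j hj).2 hle)
      obtain ⟨a', b', ha', hb', hn, hmax'⟩ := h3 j hj
      rw [entry_eq_coe.2 ha', WithBot.coe_lt_coe] at hyj
      rw [entry_eq_coe.2 hb', WithBot.coe_lt_coe]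
      -- Since `y` is strictly below `a'`, equality of the targets would make `(a', 0, b')` a
      -- transition of the tile.
      refine lt_of_le_of_ne (hmax' _ hyj.le _ hyb) fun he => hn ?_
      obtain ⟨c, hc⟩ := hyb
      rw [he] at hc
      exact UpTile.mem_of_lt_left hc hyj
    have hcard := card_filter_leaders_lt_le (s k) (w k) l
    refine ⟨_, hcard.trans hli, hgood', fun hred => ?_⟩
    have hri' := hge _ _ hgood'
    -- Either `r` is not a leader, and an index `l > r` moves left, or the next record has length
    -- `r`, too short to contain the new index, which is at least `r`.
    rcases red_spec (s k) (w k) with ⟨-, hnot⟩ | hred'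
    · rw [hred] at hnot
      rcases hli.eq_or_lt with hli | hli
      · have : r < l := lt_of_le_of_ne (by omega) fun h => hnot (h ▸ hl)
        exact (card_filter_leaders_lt_lt this hnot).trans_le hli.le
      · omega
    · have := (List.getElem?_eq_some_iff.1 hidx).1
      rw [hs, ← hred', hred] at this
      omega
  classical
  let M : ℕ → ℕ := fun k => if h : ∃ i, Good k i then Nat.find h else 0
  have hM : ∀ᶠ k in atTop, M (k + 1) ≤ M k ∧ ((s k).red (w k) = r → M (k + 1) < M k) := by
    filter_upwards [hgood, hnext] with k h1 h2
    obtain ⟨i', hi', hg', hlt'⟩ := h2 _ (Nat.find_spec h1)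
    have hMk : M k = Nat.find h1 := dif_pos h1
    have hMk' : M (k + 1) ≤ i' := by
      have : M (k + 1) = Nat.find ⟨i', hg'⟩ := dif_pos ⟨i', hg'⟩
      rw [this]
      exact Nat.find_min' _ hg'
    rw [hMk]
    exact ⟨hMk'.trans hi', fun h => hMk'.trans_lt (hlt' h)⟩
  intro hf
  refine not_frequently_lt_of_eventually_le (hM.mono fun k h => h.1) ?_
  exact (hf.and_eventually hM).mono fun k h => h.2.2 h.1

/-- If the records contain the states of a path with infinitely many Büchi transitions, then the
sequence of priorities is accepting. -/
theorem parityAccepting_of_path {w : ℕ → UpTile Q} {s : ℕ → Record Q}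
    (hs : ∀ k, s (k + 1) = (s k).next (w k)) {p : ℕ → Q}
    (hp : ∀ᶠ k in atTop, p k ∈ (s k).toList ∧ (w k).Rel (p k) (p (k + 1)))
    (hb : ∃ᶠ k in atTop, (p k, 0, p (k + 1)) ∈ (w k).carrier) :
    ParityAccepting fun k => (s k).prio (w k) := by
  obtain ⟨m, hm, hm'⟩ := exists_liminf_of_mem_Icc fun k => prio_mem (s k) (w k)
  refine ⟨m, ?_, hm, hm'⟩
  by_contra hodd
  rw [Int.not_even_iff_odd] at hodd
  obtain ⟨z, hz⟩ := hodd
  obtain ⟨k, hk⟩ := hm'.exists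
  have h1 := (prio_mem (s k) (w k)).1
  -- An odd limit `2 * z + 1` is `2 * r - 1` for `r = z + 1`; the value `-1` corresponds to `r = 0`.
  obtain ⟨r, hr⟩ : ∃ r : ℕ, z + 1 = r := ⟨(z + 1).toNat, by omega⟩
  refine not_odd_liminf hs hp hb (r := r) ?_ ?_ ?_
  · filter_upwards [hm] with k hk
    unfold prio at hk
    omega
  · filter_upwards [hm] with k hk
    unfold prio at hk
    omega
  · refine hm'.mono fun k hk => ?_
    unfold prio at hk
    omega

end

/-! ### Soundness: Büchi paths from accepting runs with `ε`-moves -/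

theorem exists_between_of_strictMono {g : ℕ → ℕ} (hg : StrictMono g) {m : ℕ} (h : g 0 ≤ m) :
    ∃ k, g k ≤ m ∧ m < g (k + 1) := by
  induction m, h using Nat.le_induction with
  | base => exact ⟨0, le_rfl, hg (Nat.lt_succ_self 0)⟩
  | succ m _ ih =>
    obtain ⟨k, hk, hm⟩ := ih
    rcases (Nat.succ_le_of_lt hm).eq_or_lt with he | hlt
    · exact ⟨k + 1, he.ge, he.trans_lt (hg (Nat.lt_succ_self _))⟩
    · exact ⟨k, hk.trans (Nat.le_succ m), hlt⟩

theorem notMem_range_of_between {g : ℕ → ℕ} (hg : StrictMono g) {k m : ℕ} (h : g k < m)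
    (h' : m < g (k + 1)) : m ∉ Set.range g := by
  rintro ⟨l, rfl⟩
  have := hg.lt_iff_lt.1 h
  have := hg.lt_iff_lt.1 h'
  omega

theorem antitone_between {α : Type*} [Preorder α] {g : ℕ → ℕ} (hg : StrictMono g) {x : ℕ → α}
    {k : ℕ} (h : ∀ m, g k < m → m ∉ Set.range g → x (m + 1) ≤ x m) {a b : ℕ} (ha : g k < a)
    (hab : a ≤ b) (hb : b ≤ g (k + 1)) : x b ≤ x a := by
  induction b, hab using Nat.le_induction with
  | base => exact le_rfl
  | succ b hab ih =>
    exact (h b (by omega) (notMem_range_of_between (k := k) hg (by omega) (by omega))).trans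
      (ih (by omega))

theorem frequently_of_frequently_mem_range {g : ℕ → ℕ} (hg : StrictMono g) {P : ℕ → Prop}
    (h : ∃ᶠ m in atTop, m ∈ Set.range g ∧ P m) : ∃ᶠ k in atTop, P (g k) := by
  rw [frequently_atTop] at h ⊢
  intro k
  obtain ⟨_, hm, ⟨l, rfl⟩, hP⟩ := h (g k)
  exact ⟨l, hg.le_iff_le.1 hm, hP⟩

section

variable {Q : Type*} [LinearOrder Q]

/-- A path that may jump to smaller states between the letters gives a path without jumps, and
strict jumps give Büchi transitions. -/
theorem exists_path_of_jumps {w : ℕ → UpTile Q} {g : ℕ → ℕ} (hg : StrictMono g)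
    {x : ℕ → WithBot Q}
    (hl : ∀ᶠ k in atTop, ∃ a b : Q, x (g k) = a ∧ x (g k + 1) = b ∧ (w k).Rel a b)
    (he : ∀ᶠ m in atTop, m ∉ Set.range g → x (m + 1) ≤ x m)
    (hb : (∃ᶠ k in atTop, ∃ a b : Q, x (g k) = a ∧ x (g k + 1) = b ∧ (a, 0, b) ∈ (w k).carrier) ∨
      ∃ᶠ m in atTop, m ∉ Set.range g ∧ x (m + 1) < x m) :
    ∃ p : ℕ → Q, (∀ᶠ k in atTop, x (g k) = p k ∧ (w k).Rel (p k) (p (k + 1))) ∧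
      ∃ᶠ k in atTop, (p k, 0, p (k + 1)) ∈ (w k).carrier := by
  have he' : ∀ᶠ k in atTop, ∀ m, g k < m → m ∉ Set.range g → x (m + 1) ≤ x m := by
    obtain ⟨K, hK⟩ := eventually_atTop.1 he
    filter_upwards [eventually_ge_atTop K] with k hk m hm hmg
    exact hK m ((hk.trans (hg.le_apply)).trans hm.le) hmg
  -- Where `x (g k)` is `⊥`, which eventually never happens, an arbitrary state serves as a default
  -- value.
  have hex : ∀ k, ∃ a : Q, (∃ b : Q, x (g k) = b) → x (g k) = a := by
    obtain ⟨k, a, -⟩ := hl.exists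
    intro k
    by_cases h : ∃ b : Q, x (g k) = b
    · obtain ⟨b, hb⟩ := h
      exact ⟨b, fun _ => hb⟩
    · exact ⟨a, fun h' => absurd h' h⟩
  choose p hp using hex
  have hstep : ∀ᶠ k in atTop, x (g k) = p k ∧ x (g (k + 1)) = p (k + 1) ∧
      ∃ b : Q, x (g k + 1) = b ∧ (w k).Rel (p k) b ∧ p (k + 1) ≤ b := by
    filter_upwards [hl, (tendsto_add_atTop_nat 1).eventually hl, he'] with k h1 h2 h3
    obtain ⟨a, b, ha, hb, hab⟩ := h1
    obtain ⟨a', -, ha', -⟩ := h2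
    have e1 := hp k ⟨a, ha⟩
    have e2 := hp (k + 1) ⟨a', ha'⟩
    refine ⟨e1, e2, b, hb, ?_, ?_⟩
    · rw [e1, WithBot.coe_inj] at ha
      rwa [ha]
    · rw [← WithBot.coe_le_coe, ← e2, ← hb]
      exact antitone_between hg h3 (by omega) (hg (Nat.lt_succ_self k)) le_rfl
  refine ⟨p, hstep.mono fun k ⟨h1, _, b, _, h3, h4⟩ => ⟨h1, rel_of_le h3 le_rfl h4⟩, ?_⟩
  rcases hb with hb | hb
  · refine (hb.and_eventually hstep).mono ?_
    rintro k ⟨⟨a, b, ha, hb, hab⟩, h1, -, b', hb', -, hle⟩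
    rw [h1, WithBot.coe_inj] at ha
    rw [hb', WithBot.coe_inj] at hb
    subst ha hb
    rcases hle.eq_or_lt with h | h
    · rwa [h]
    · exact UpTile.mem_of_lt_right hab h
  · rw [frequently_atTop] at hb ⊢
    intro k₀
    obtain ⟨K, hK⟩ := eventually_atTop.1 (hstep.and he')
    obtain ⟨m, hm, hmg, hlt⟩ := hb (g (max k₀ K))
    obtain ⟨k, hkm, hmk⟩ := exists_between_of_strictMono hg
      ((hg.monotone (Nat.zero_le _)).trans hm)
    have hk : max k₀ K ≤ k := by
      have := hg.lt_iff_lt.1 (hm.trans_lt hmk)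
      omega
    have hkm' : g k < m := lt_of_le_of_ne hkm fun h => hmg ⟨k, h⟩
    obtain ⟨⟨h1, h2, b, hb, ⟨c, hc⟩, -⟩, h3⟩ := hK k (by omega)
    -- The strict jump at `m` lies between letters `k` and `k + 1`, so `p (k + 1)` is strictly below
    -- the target `b` reached by letter `k`.
    refine ⟨k, by omega, UpTile.mem_of_lt_right hc ?_⟩
    rw [← WithBot.coe_lt_coe, ← h2, ← hb]
    exact ((antitone_between hg h3 (by omega) hmk le_rfl).trans_lt hlt).trans_le
      (antitone_between hg h3 (by omega) hkm' hmk.le)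

variable [Fintype Q]

open Record

/-- An accepting run that may decrease prefixes of records between the letters contains a path
with infinitely many Büchi transitions. -/
theorem exists_path_of_parityAccepting {w : ℕ → UpTile Q} {g : ℕ → ℕ} (hg : StrictMono g)
    {q : ℕ → Record Q} {c : ℕ → ℤ}
    (hl : ∀ k, q (g k + 1) = (q (g k)).next (w k) ∧ c (g k) = (q (g k)).prio (w k))
    (he : ∀ m ∉ Set.range g, ∃ i : ℕ, ((q (m + 1)).pre i < (q m).pre i ∧ c m = 2 * i) ∨
      ((q (m + 1)).pre i ≤ (q m).pre i ∧ c m = 2 * i + 1))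
    (hc : ParityAccepting c) :
    ∃ p : ℕ → Q, (∀ᶠ k in atTop, p k ∈ (q (g k)).toList ∧ (w k).Rel (p k) (p (k + 1))) ∧
      ∃ᶠ k in atTop, (p k, 0, p (k + 1)) ∈ (w k).carrier := by
  obtain ⟨z, hz, hmin, hinf⟩ := hc
  -- An even value that is at least `-1` is nonnegative.
  obtain ⟨e, rfl⟩ : ∃ e : ℕ, z = 2 * e := by
    obtain ⟨y, rfl⟩ := hz
    obtain ⟨m, hm⟩ := hinf.exists
    have hlow : -1 ≤ c m := by
      by_cases h : m ∈ Set.range g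
      · obtain ⟨k, rfl⟩ := h
        rw [(hl k).2]
        exact (prio_mem _ _).1
      · obtain ⟨i, ⟨-, h⟩ | ⟨-, h⟩⟩ := he m h <;> omega
    exact ⟨y.toNat, by omega⟩
  have hred : ∀ᶠ k in atTop, e < (q (g k)).red (w k) := by
    filter_upwards [hg.tendsto_atTop.eventually hmin] with k h
    rw [(hl k).2, prio] at h
    omega
  have hpre : ∀ᶠ m in atTop, m ∉ Set.range g → (q (m + 1)).pre e ≤ (q m).pre e := by
    filter_upwards [hmin] with m h hm
    obtain ⟨i, ⟨h1, h2⟩ | ⟨h1, h2⟩⟩ := he m hm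
    · exact pre_mono (by omega) h1.le
    · exact pre_mono (by omega) h1
  let Step : ℕ → ℕ → Prop := fun j k => ∃ a b : Q, (q (g k)).entry j = a ∧
    (q (g k + 1)).entry j = b ∧ (w k).Rel a b
  have hstep : ∀ k j, j ≤ e → e < (q (g k)).red (w k) → j < (q (g k)).toList.length →
      Step j k := by
    intro k j hj hr hlen
    obtain ⟨a, b, ha, hb, hab, -⟩ := exists_step_of_lt_red hlen (hj.trans_lt hr)
    exact ⟨a, b, entry_eq_coe.2 ha, by rw [(hl k).1]; exact entry_eq_coe.2 hb, hab⟩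
  let Ch : ℕ → Prop := fun j => ∃ᶠ m in atTop, m ∉ Set.range g ∧
    (q (m + 1)).entry j ≠ (q m).entry j
  have hconst : ∀ j, ¬ Ch j → ∀ᶠ m in atTop, m ∉ Set.range g →
      (q (m + 1)).entry j = (q m).entry j := fun j h =>
    (not_frequently.1 h).mono fun m hm hmg => by_contra fun hne => hm ⟨hmg, hne⟩
  -- the path of the entries of index `j`
  have key : ∀ j ≤ e, (∀ᶠ k in atTop, Step j k) → (∀ j' < j, ¬ Ch j') →
      (Ch j ∨ ∃ᶠ k in atTop, ∃ a b : Q, (q (g k)).entry j = a ∧ (q (g k + 1)).entry j = b ∧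
        (a, 0, b) ∈ (w k).carrier) →
      ∃ p : ℕ → Q, (∀ᶠ k in atTop, p k ∈ (q (g k)).toList ∧ (w k).Rel (p k) (p (k + 1))) ∧
        ∃ᶠ k in atTop, (p k, 0, p (k + 1)) ∈ (w k).carrier := by
    intro j hj hs hlt hb
    have hle : ∀ᶠ m in atTop, m ∉ Set.range g → (q (m + 1)).entry j ≤ (q m).entry j := by
      have hall := (eventually_all_finite (Set.finite_Iio j)).2 fun j' hj' => hconst j' (hlt j' hj')
      filter_upwards [hpre, hall] with m h1 h2 hm
      exact entry_le_of_pre_le hj (h1 hm) fun j' hj' => h2 j' hj' hm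
    obtain ⟨p, hp, hp'⟩ := exists_path_of_jumps (x := fun m => (q m).entry j) hg hs hle (by
      rcases hb with hb | hb
      · right
        refine (hb.and_eventually hle).mono ?_
        rintro m ⟨⟨h1, h2⟩, h3⟩
        exact ⟨h1, lt_of_le_of_ne (h3 h1) h2⟩
      · exact Or.inl hb)
    exact ⟨p, hp.mono fun k ⟨h1, h2⟩ => ⟨List.mem_of_getElem? (entry_eq_coe.1 h1), h2⟩, hp'⟩
  have hlen : ∀ k, e < (q (g k)).red (w k) → e < (q (g k + 1)).toList.length := by
    intro k hk
    rw [(hl k).1]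
    exact hk.trans_le (red_le_length_next _ _)
  -- Index `0` is treated apart: it only needs nonempty records, whereas larger indices need records
  -- longer than `e`, which is ensured once `ε`-moves no longer change entry `0`.
  by_cases h0 : Ch 0
  · refine key 0 (Nat.zero_le e) (hred.mono fun k hk => hstep k 0 (Nat.zero_le e) hk ?_) (by simp)
      (Or.inl h0)
    have h1 := hlen k hk
    rw [(hl k).1] at h1
    obtain ⟨y, hy, -⟩ := mem_next.1 (List.getElem_mem h1)
    exact List.length_pos_of_mem hy
  -- the length of the records is eventually constant between the letters
  have hlong : ∀ᶠ m in atTop, e < (q m).toList.length := by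
    obtain ⟨K, hK⟩ := eventually_atTop.1 hred
    refine eventually_of_frequently_of_step ?_ ?_
    · refine frequently_atTop.2 fun m => ⟨g (max m K) + 1, ?_, hlen _ (hK _ (by omega))⟩
      have := hg.le_apply (x := max m K)
      omega
    · filter_upwards [hconst 0 h0, eventually_ge_atTop (g K)] with m h1 h2 h3
      by_cases hm : m ∈ Set.range g
      · obtain ⟨k, rfl⟩ := hm
        exact hlen k (hK k (hg.le_iff_le.1 h2))
      · rwa [length_eq_of_entry_zero_eq (h1 hm)]
  have hsteps : ∀ j ≤ e, ∀ᶠ k in atTop, Step j k := fun j hj => by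
    filter_upwards [hred, hg.tendsto_atTop.eventually hlong] with k h1 h2
    exact hstep k j hj h1 (hj.trans_lt h2)
  by_cases hch : ∃ j ≤ e, Ch j
  · classical
    obtain ⟨h1, h2⟩ := Nat.find_spec hch
    exact key _ h1 (hsteps _ h1) (fun j' hj' h =>
      Nat.find_min hch hj' ⟨hj'.le.trans h1, h⟩) (Or.inl h2)
  · push Not at hch
    refine key e le_rfl (hsteps e le_rfl) (fun j' hj' => hch j' hj'.le) (Or.inr ?_)
    have hall := (eventually_all_finite (Set.finite_Iic e)).2 fun j hj => hconst j (hch j hj)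
    -- An `ε`-move of priority `2 * e` strictly decreases the prefix of index `e`, hence changes one
    -- of its entries; eventually this no longer occurs.
    have hfreq : ∃ᶠ k in atTop, c (g k) = 2 * e := by
      refine frequently_of_frequently_mem_range hg (P := fun m => c m = 2 * e)
        ((hinf.and_eventually hall).mono ?_)
      rintro m ⟨h1, h2⟩
      refine ⟨by_contra fun hm => ?_, h1⟩
      obtain ⟨i, ⟨h3, h4⟩ | ⟨-, h4⟩⟩ := he m hm
      · obtain rfl : i = e := by omega
        obtain ⟨j, hj, hne⟩ := exists_entry_ne_of_pre_lt h3
        exact hne (h2 j hj hm)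
      · omega
    refine (hfreq.and_eventually hred).mono ?_
    rintro k ⟨h1, h2⟩
    rw [(hl k).2, prio] at h1
    have hgr : (q (g k)).green (w k) = e := by omega
    obtain ⟨a, b, ha, hb, hab⟩ := exists_of_green_lt_red (s := q (g k)) (t := w k) (by omega)
    rw [hgr] at ha hb
    exact ⟨a, b, entry_eq_coe.2 ha, by rw [(hl k).1]; exact entry_eq_coe.2 hb, hab⟩

/-- The states of a run that may decrease prefixes of records between the letters belong to the
records of the run without these decreases. -/
theorem mem_of_mem_run {w : ℕ → UpTile Q} {g : ℕ → ℕ} (hg : StrictMono g)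
    {q : ℕ → Record Q} (hl : ∀ k, q (g k + 1) = (q (g k)).next (w k))
    (he : ∀ m ∉ Set.range g, ∃ i : ℕ, (q (m + 1)).pre i ≤ (q m).pre i)
    {s : ℕ → Record Q} (h0 : s 0 = q 0) (hs : ∀ k, s (k + 1) = (s k).next (w k)) (k : ℕ)
    {x : Q} (hx : x ∈ (q (g k)).toList) : x ∈ (s k).toList := by
  have heps : ∀ m ∉ Set.range g, {x | x ∈ (q (m + 1)).toList} ⊆ {x | x ∈ (q m).toList} := by
    intro m hm x hx
    obtain ⟨i, hi⟩ := he m hm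
    exact mem_of_pre_le hi hx
  suffices h : {x | x ∈ (q (g k)).toList} ⊆ {x | x ∈ (s k).toList} from h hx
  clear hx
  induction k with
  | zero =>
    have : ∀ m ≤ g 0, {x | x ∈ (q m).toList} ⊆ {x | x ∈ (s 0).toList} := by
      intro m hm
      induction m with
      | zero => rw [h0]
      | succ m ih =>
        refine (heps m ?_).trans (ih (by omega))
        rintro ⟨l, rfl⟩
        have := hg.monotone (Nat.zero_le l)
        omega
    exact this _ le_rfl
  | succ k ih =>
    refine (antitone_between (x := fun m => {x | x ∈ (q m).toList}) hg (k := k)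
      (fun m _ hm => heps m hm) (Nat.lt_succ_self _) (hg (Nat.lt_succ_self k)) le_rfl).trans ?_
    intro x hx
    change x ∈ (q (g k + 1)).toList at hx
    change x ∈ (s (k + 1)).toList
    rw [hl, mem_next] at hx
    rw [hs, mem_next]
    obtain ⟨y, hy, hr⟩ := hx
    exact ⟨y, ih hy, hr⟩

end

/-! ### Restriction, normalization and addition of `ε`-transitions -/

namespace ParityAutomaton

variable {Letter State : Type*}

theorem HasIndex.restrict {A : ParityAutomaton Letter State} {lo hi : ℤ} (h : A.HasIndex lo hi)
    (X : Set State) : (A.restrict X).HasIndex lo hi := fun _ _ _ _ hδ => h _ _ _ _ hδ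

theorem EpsPreorders.restrict {A : ParityAutomaton (Option Letter) State} {d : ℕ}
    (h : A.EpsPreorders d) (X : Set State) : (A.restrict X).EpsPreorders d where
  trans_odd i hi _ _ _ := h.trans_odd i hi _ _ _
  total_odd i hi _ _ := h.total_odd i hi _ _
  refines i hi _ _ := h.refines i hi _ _
  even_iff i hi _ _ := h.even_iff i hi _ _

theorem epsLanguage_restrict_subset (A : ParityAutomaton (Option Letter) State) (X : Set State) :
    (A.restrict X).epsLanguage ⊆ A.epsLanguage := by
  rintro w ⟨w', ⟨q, c, h0, hq, hc⟩, hw⟩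
  exact ⟨w', ⟨fun k => q k, c, h0, hq, hc⟩, hw⟩

/-- A run without `ε` visits only accessible states, so it survives in the restriction. -/
theorem language_subset_epsLanguage_restrict (A : ParityAutomaton Letter State)
    (E : Set (State × ℤ × State)) {X : Set State} (hX : ∀ s, A.Accessible s → s ∈ X) :
    A.language ⊆ ((A.addEps E).restrict X).epsLanguage := by
  rintro w ⟨q, c, h0, hq, hc⟩
  have hacc : ∀ k, A.Accessible (q k) := fun k => by
    induction k with
    | zero => exact .init _ h0
    | succ k ih => exact .step _ _ _ _ ih (hq k)
  exact ⟨fun k => some (w k), ⟨fun k => ⟨q k, hX _ (hacc k)⟩, c, h0,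
    fun k => Or.inl ⟨w k, rfl, hq k⟩, hc⟩, id, strictMono_id, fun _ => rfl, fun m _ => ⟨m, rfl⟩⟩

theorem Accessible.of_normalize {A : ParityAutomaton Letter State} {s : State}
    (h : A.normalize.Accessible s) : A.Accessible s := by
  induction h with
  | init q h => exact .init q h
  | step q a c q' _ h ih =>
    obtain ⟨c', hc', -⟩ := h
    exact .step q a c' q' ih hc'

/-- The even limit of an accepting run is nonnegative, so `-1` occurs only finitely often and its
replacement does not affect acceptance. -/
theorem language_subset_language_normalize {A : ParityAutomaton Letter State} {hi : ℤ}
    (hA : A.HasIndex (-1) hi) : A.language ⊆ A.normalize.language := by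
  rintro w ⟨q, c, h0, hq, m, hm, hmin, hinf⟩
  refine ⟨q, fun k => if c k = -1 then 1 else c k, h0, fun k => ⟨c k, hq k, rfl⟩, m, hm, ?_⟩
  have hpos : 0 ≤ m := by
    obtain ⟨k, hk⟩ := hinf.exists
    have := (hA _ _ _ _ (hq k)).1
    obtain ⟨y, rfl⟩ := hm
    omega
  have heq : ∀ᶠ k in atTop, (if c k = -1 then 1 else c k) = c k :=
    hmin.mono fun k hk => if_neg (by omega)
  refine ⟨?_, ?_⟩
  · filter_upwards [hmin, heq] with k h1 h2
    rwa [h2]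
  · exact (hinf.and_eventually heq).mono fun k h => h.2.trans h.1

theorem HasIndex.normalize {A : ParityAutomaton Letter State} {d : ℕ}
    (h : A.HasIndex (-1) (2 * d + 1)) : A.normalize.HasIndex 0 (2 * d + 1) := by
  rintro q a c q' ⟨c', hc', rfl⟩
  obtain ⟨h1, h2⟩ := h _ _ _ _ hc'
  split_ifs with h3
  · constructor <;> omega
  · constructor <;> omega

theorem epsRel_addEps {A : ParityAutomaton Letter State} {E : Set (State × ℤ × State)} {c : ℤ}
    {p q : State} : (A.addEps E).EpsRel c p q ↔ (p, c, q) ∈ E := by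
  simp [EpsRel, addEps]

theorem some_mem_addEps {A : ParityAutomaton Letter State} {E : Set (State × ℤ × State)} {a : Letter}
    {c : ℤ} {p q : State} : (p, some a, c, q) ∈ (A.addEps E).trans ↔ (p, a, c, q) ∈ A.trans := by
  simp [addEps]

end ParityAutomaton

/-! ### The determinized automaton with its `ε`-transitions -/

section

variable {Q : Type*} [LinearOrder Q] [Fintype Q]

open ParityAutomaton Record

theorem mem_epsTransitions {s s' : Record Q} {c : ℤ} : (s, c, s') ∈ epsTransitions Q ↔
    ∃ i : ℕ, i < Fintype.card Q ∧ ((s'.pre i < s.pre i ∧ c = 2 * i) ∨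
      (s'.pre i ≤ s.pre i ∧ c = 2 * i + 1)) := by
  constructor
  · rintro ⟨i, a, b, hi, ⟨h, he⟩ | ⟨h, he⟩⟩ <;> cases he
    · exact ⟨i, hi, Or.inl ⟨h, rfl⟩⟩
    · exact ⟨i, hi, Or.inr ⟨h, rfl⟩⟩
  · rintro ⟨i, hi, ⟨h, rfl⟩ | ⟨h, rfl⟩⟩
    · exact ⟨i, s, s', hi, Or.inl ⟨h, rfl⟩⟩
    · exact ⟨i, s', s, hi, Or.inr ⟨h, rfl⟩⟩

theorem odd_mem_epsTransitions {s s' : Record Q} {i : ℕ} (hi : i < Fintype.card Q) :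
    (s, 2 * (i : ℤ) + 1, s') ∈ epsTransitions Q ↔ s'.pre i ≤ s.pre i := by
  rw [mem_epsTransitions]
  constructor
  · rintro ⟨j, -, ⟨h, hc⟩ | ⟨h, hc⟩⟩
    · omega
    · obtain rfl : i = j := by omega
      exact h
  · exact fun h => ⟨i, hi, Or.inr ⟨h, rfl⟩⟩

theorem even_mem_epsTransitions {s s' : Record Q} {i : ℕ} (hi : i < Fintype.card Q) :
    (s, 2 * (i : ℤ), s') ∈ epsTransitions Q ↔ s'.pre i < s.pre i := by
  rw [mem_epsTransitions]
  constructor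
  · rintro ⟨j, -, ⟨h, hc⟩ | ⟨h, hc⟩⟩
    · obtain rfl : i = j := by omega
      exact h
    · omega
  · exact fun h => ⟨i, hi, Or.inl ⟨h, rfl⟩⟩

theorem epsPreorders_addEps {Letter : Type*} (A : ParityAutomaton Letter (Record Q)) {d : ℕ}
    (hd : Fintype.card Q = d + 1) : (A.addEps (epsTransitions Q)).EpsPreorders d where
  trans_odd i hi p q r hpq hqr := by
    rw [epsRel_addEps, odd_mem_epsTransitions (by omega)] at *
    exact hqr.trans hpq
  total_odd i hi p q := by
    simp only [epsRel_addEps, odd_mem_epsTransitions (show i < Fintype.card Q by omega)]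
    exact le_total _ _
  refines i hi p q h := by
    have h' : (p, 2 * ((i + 1 : ℕ) : ℤ) + 1, q) ∈ epsTransitions Q := by
      rw [epsRel_addEps] at h
      exact_mod_cast h
    rw [odd_mem_epsTransitions (by omega)] at h'
    rw [epsRel_addEps, odd_mem_epsTransitions (by omega)]
    exact pre_mono (Nat.le_succ i) h'
  even_iff i hi p q := by
    rw [epsRel_addEps, epsRel_addEps, odd_mem_epsTransitions (by omega),
      even_mem_epsTransitions (by omega)]
    exact not_le.symm

theorem hasIndex_addEps {Letter : Type*} {A : ParityAutomaton Letter (Record Q)} {d : ℕ}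
    (hd : Fintype.card Q = d + 1) (h : A.HasIndex 0 (2 * d + 1)) :
    (A.addEps (epsTransitions Q)).HasIndex 0 (2 * d + 1) := by
  rintro q a c q' (⟨b, -, hb⟩ | ⟨-, hE⟩)
  · exact h _ _ _ _ hb
  · obtain ⟨i, hi, ⟨-, rfl⟩ | ⟨-, rfl⟩⟩ := mem_epsTransitions.1 hE <;> constructor <;> omega

namespace OrderedBuchiAutomaton

variable (B : OrderedBuchiAutomaton Q)

theorem mem_det_trans {s s' : Record Q} {t : B.tiles} {c : ℤ} :
    (s, t, c, s') ∈ B.det.trans ↔ c = s.prio t.1 ∧ s' = s.next t.1 := by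
  simp [det]

theorem hasIndex_det {d : ℕ} (hd : Fintype.card Q = d + 1) :
    B.det.HasIndex (-1) (2 * d + 1) := by
  intro q a c q' h
  obtain ⟨rfl, -⟩ := B.mem_det_trans.1 h
  obtain ⟨h1, h2⟩ := prio_mem q a.1
  exact ⟨h1, by omega⟩

theorem epsLanguage_addEps_subset :
    (B.det.addEps (epsTransitions Q)).epsLanguage ⊆ B.det.language := by
  rintro w ⟨w', ⟨q, c, h0, hq, hc⟩, g, hg, hgw, hrange⟩
  have hl : ∀ k, q (g k + 1) = (q (g k)).next (w k).1 ∧ c (g k) = (q (g k)).prio (w k).1 := by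
    intro k
    have := hq (g k)
    rw [hgw, some_mem_addEps, mem_det_trans] at this
    exact this.symm
  have he : ∀ m ∉ Set.range g, ∃ i : ℕ, ((q (m + 1)).pre i < (q m).pre i ∧ c m = 2 * i) ∨
      ((q (m + 1)).pre i ≤ (q m).pre i ∧ c m = 2 * i + 1) := by
    intro m hm
    have hn : w' m = none := by_contra fun h => hm (hrange m h)
    have := hq m
    rw [hn] at this
    obtain ⟨i, -, h⟩ := mem_epsTransitions.1 (epsRel_addEps.1 this)
    exact ⟨i, h⟩
  obtain ⟨p, hp, hb⟩ := exists_path_of_parityAccepting (w := fun k => (w k).1) hg hl he hc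
  let s : ℕ → Record Q := fun k => Nat.rec B.initRecord (fun k r => r.next (w k).1) k
  have h0' : q 0 = B.initRecord := h0
  refine ⟨s, fun k => (s k).prio (w k).1, rfl, fun k => B.mem_det_trans.2 ⟨rfl, rfl⟩, ?_⟩
  refine parityAccepting_of_path (w := fun k => (w k).1) (fun _ => rfl) (hp.mono fun k h => ?_) hb
  refine ⟨mem_of_mem_run (w := fun k => (w k).1) hg (fun k => (hl k).1) (fun m hm => ?_) h0'.symm
    (fun _ => rfl) k h.1, h.2⟩
  obtain ⟨i, ⟨h, -⟩ | ⟨h, -⟩⟩ := he m hm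
  exacts [⟨i, h.le⟩, ⟨i, h⟩]

/-- From the empty record, only the empty record can be reached, and only with odd priorities. An
accepting run thus has nonempty records throughout, so by `red_pos` no priority was replaced and the
same run is a run of the original automaton. -/
theorem epsLanguage_normalize_addEps_subset :
    (B.det.normalize.addEps (epsTransitions Q)).epsLanguage ⊆
      (B.det.addEps (epsTransitions Q)).epsLanguage := by
  rintro w ⟨w', ⟨q, c, h0, hq, hc⟩, hw⟩
  refine ⟨w', ⟨q, c, h0, ?_, hc⟩, hw⟩
  -- every transition is over `ε`, or over a letter
  have hcases : ∀ k, (∃ t, w' k = some t ∧ q (k + 1) = (q k).next t.1 ∧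
        c k = if (q k).prio t.1 = -1 then 1 else (q k).prio t.1) ∨
      (w' k = none ∧ (q k, c k, q (k + 1)) ∈ epsTransitions Q) := by
    intro k
    have := hq k
    cases hk : w' k with
    | none =>
      rw [hk] at this
      exact Or.inr ⟨rfl, epsRel_addEps.1 this⟩
    | some t =>
      rw [hk, some_mem_addEps] at this
      obtain ⟨c', hc', hcc⟩ := this
      obtain ⟨rfl, h⟩ := B.mem_det_trans.1 hc'
      exact Or.inl ⟨t, rfl, h, hcc⟩
  have hback : ∀ k, (∃ x, x ∈ (q (k + 1)).toList) → ∃ x, x ∈ (q k).toList := by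
    rintro k ⟨x, hx⟩
    rcases hcases k with ⟨t, -, h, -⟩ | ⟨-, h⟩
    · rw [h] at hx
      obtain ⟨y, hy, -⟩ := mem_next.1 hx
      exact ⟨y, hy⟩
    · obtain ⟨i, -, ⟨h, -⟩ | ⟨h, -⟩⟩ := mem_epsTransitions.1 h
      · exact ⟨x, mem_of_pre_le h.le hx⟩
      · exact ⟨x, mem_of_pre_le h hx⟩
  have heven : ∀ k, Even (c k) → ∃ x, x ∈ (q k).toList := by
    intro k hk
    by_contra hemp
    have hemp' : ¬ ∃ x, x ∈ (q (k + 1)).toList := fun h => hemp (hback k h)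
    rcases hcases k with ⟨t, -, h, hck⟩ | ⟨-, h⟩
    · have hlen : ((q k).next t.1).toList.length = 0 := by
        rw [← h, List.length_eq_zero_iff, List.eq_nil_iff_forall_not_mem]
        exact fun x hx => hemp' ⟨x, hx⟩
      have hr := red_le_length_next (q k) t.1
      have : (q k).prio t.1 = -1 := by
        unfold prio
        omega
      rw [if_pos this] at hck
      rw [hck] at hk
      exact absurd hk (by decide)
    · obtain ⟨i, -, ⟨h, -⟩ | ⟨-, h⟩⟩ := mem_epsTransitions.1 h
      · have heq : q (k + 1) = q k := by
          refine Record.ext ?_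
          rw [List.eq_nil_iff_forall_not_mem.2 fun x hx => hemp ⟨x, hx⟩,
            List.eq_nil_iff_forall_not_mem.2 fun x hx => hemp' ⟨x, hx⟩]
        rw [heq] at h
        exact lt_irrefl _ h
      · rw [h] at hk
        obtain ⟨y, hy⟩ := hk
        omega
  -- An even priority occurs after any given time; nonemptiness goes backwards from there.
  have hne : ∀ k, ∃ x, x ∈ (q k).toList := by
    intro k
    obtain ⟨m, hm, -, hinf⟩ := hc
    obtain ⟨l, hl, hcl⟩ := frequently_atTop.1 hinf k
    have : ∀ j, ∃ x, x ∈ (q (l - j)).toList := by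
      intro j
      induction j with
      | zero => exact heven l (hcl ▸ hm)
      | succ j ih =>
        by_cases h : l ≤ j
        · rwa [show l - (j + 1) = l - j by omega]
        · exact hback _ (by rwa [show l - (j + 1) + 1 = l - j by omega])
    simpa [show l - (l - k) = k by omega] using this (l - k)
  intro k
  rcases hcases k with ⟨t, hk, h, hck⟩ | ⟨hk, h⟩
  · rw [hk, some_mem_addEps, mem_det_trans]
    refine ⟨?_, h⟩
    obtain ⟨x, hx⟩ := hne (k + 1)
    rw [h] at hx
    have := red_pos hx
    rw [hck, if_neg]
    unfold prio
    omega
  · rw [hk]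
    exact epsRel_addEps.2 h

end OrderedBuchiAutomaton

end

end OrderedBuchi

theorem mainTheorem9 {Q : Type*} [LinearOrder Q] [Fintype Q]
    (B : OrderedBuchi.OrderedBuchiAutomaton Q)
    (d : ℕ) (hd : Fintype.card Q = d + 1) :
    B.det.HasIndex (-1) (2 * d + 1) ∧
    (B.det.addEps (OrderedBuchi.epsTransitions Q)).EpsPreorders d ∧
    (B.det.addEps (OrderedBuchi.epsTransitions Q)).epsLanguage = B.det.language ∧
    (B.det.normalize.addEps (OrderedBuchi.epsTransitions Q)).IsEpsComplete d ∧
    (B.det.normalize.addEps (OrderedBuchi.epsTransitions Q)).epsLanguage = B.det.language ∧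
    ∀ X : Set (OrderedBuchi.Record Q), (∀ s, B.det.Accessible s → s ∈ X) →
      ((B.det.addEps (OrderedBuchi.epsTransitions Q)).restrict X).EpsPreorders d ∧
      ((B.det.addEps (OrderedBuchi.epsTransitions Q)).restrict X).epsLanguage = B.det.language ∧
      ((B.det.normalize.addEps (OrderedBuchi.epsTransitions Q)).restrict X).IsEpsComplete d ∧
      ((B.det.normalize.addEps (OrderedBuchi.epsTransitions Q)).restrict X).epsLanguage =
        B.det.language := by
  have hidx := B.hasIndex_det hd
  have hpre := OrderedBuchi.epsPreorders_addEps B.det hd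
  have hcomp : (B.det.normalize.addEps (OrderedBuchi.epsTransitions Q)).IsEpsComplete d :=
    ⟨OrderedBuchi.hasIndex_addEps hd hidx.normalize, OrderedBuchi.epsPreorders_addEps _ hd⟩
  have hsound := B.epsLanguage_addEps_subset
  have hsound' := B.epsLanguage_normalize_addEps_subset.trans hsound
  have hX : ∀ X : Set (OrderedBuchi.Record Q), (∀ s, B.det.Accessible s → s ∈ X) →
      B.det.language ⊆
        ((B.det.addEps (OrderedBuchi.epsTransitions Q)).restrict X).epsLanguage :=
    fun X hX => B.det.language_subset_epsLanguage_restrict _ hX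
  have hX' : ∀ X : Set (OrderedBuchi.Record Q), (∀ s, B.det.Accessible s → s ∈ X) →
      B.det.language ⊆
        ((B.det.normalize.addEps (OrderedBuchi.epsTransitions Q)).restrict X).epsLanguage :=
    fun X hX => (OrderedBuchi.ParityAutomaton.language_subset_language_normalize hidx).trans
      (B.det.normalize.language_subset_epsLanguage_restrict _ fun s hs => hX s hs.of_normalize)
  have hres := fun X => (B.det.addEps
    (OrderedBuchi.epsTransitions Q)).epsLanguage_restrict_subset X
  have hres' := fun X => (B.det.normalize.addEps
    (OrderedBuchi.epsTransitions Q)).epsLanguage_restrict_subset X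
  -- The unrestricted inclusions are obtained from the restricted ones with `X = Set.univ`.
  refine ⟨hidx, hpre, hsound.antisymm ((hX Set.univ fun _ _ => trivial).trans (hres _)), hcomp,
    hsound'.antisymm ((hX' Set.univ fun _ _ => trivial).trans (hres' _)), fun X h => ⟨?_, ?_, ?_, ?_⟩⟩
  · exact hpre.restrict X
  · exact ((hres X).trans hsound).antisymm (hX X h)
  · exact ⟨hcomp.1.restrict X, hcomp.2.restrict X⟩
  · exact ((hres' X).trans hsound').antisymm (hX' X h)
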